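/- Let $(\mathcal X,\mathcal A,\lambda)$ be a probability space, let $V$ be a finite-dimensional real inner product space with norm $|\cdot|_V$, and let $\Theta$ be a subset of a real Hilbert space $\mathbb H$. For every $\theta\in\Theta$ let $\mathscr G(\theta):\mathcal X\to V$ be a measurable map, and let $P_\theta$ be the law on $V\times\mathcal X$ of $(Y,X)$, where $Y=\mathscr G(\theta)(X)+\varepsilon$ with $X\sim\lambda$ and $\varepsilon\sim\mathcal N(0,I_V)$ independent. Let $P_\theta^N=\otimes_{i=1}^N P_\theta$ on $(V\times\mathcal X)^N$. Fix $\theta\in\Theta$ and a linear subspace $H\subset\mathbb H$ such that for every $h\in H$ one has $\theta+sh\in\Theta$ for all sufficiently small $|s|$. Suppose that: (i) $\sup_{\theta'\in\Theta}\sup_{x\in\mathcal X}|\mathscr G(\theta')(x)|_V<\infty$; (ii) there is a continuous linear operator $\mathbb I_\theta:(H,\|\cdot\|_{\mathbb H})\to L^2_\lambda(\mathcal X,V)$ such that for every $h\in H$, for some representative of $\mathbb I_\theta[h]$ and all $x\in\mathcal X$, $$|\mathscr G(\theta+sh)(x)-\mathscr G(\theta)(x)-s\,\mathbb I_\theta[h](x)|_V=o(s)\quad\text{as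 } s\to0;$$ (iii) for every $h\in H$ there are $\epsilon>0$ and $B<\infty$ (which may depend on $h$ and $\theta$) such that $$\sup_{0<|s|<\epsilon}\frac{\sup_{x\in\mathcal X}|\mathscr G(\theta+sh)(x)-\mathscr G(\theta)(x)|_V}{|s|}\le B.$$ Write $\|h\|_{LAN}=\|\mathbb I_\theta h\|_{L^2_\lambda(\mathcal X,V)}$ for $h\in H$, and let $D_N=(Y_i,X_i)_{i=1}^N\sim P_\theta^N$ for each $N$. Then for every $h\in H$ the measures $P^N_{\theta+h/\sqrt N}$ and $P^N_\theta$ are mutually absolutely continuous for all sufficiently large $N$, and $$\log\frac{dP^N_{\theta+h/\sqrt N}}{dP^N_\theta}(D_N)\;\xrightarrow{\;d\;}\;\mathcal N\Big(-\tfrac12\|h\|_{LAN}^2,\ \|h\|_{LAN}^2\Big)\qquad\text{as } N\to\infty,$$ where $\mathcal N(0,0)$ denotes the point mass at $0$. -/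

import Mathlib

open MeasureTheory ProbabilityTheory Filter Topology Asymptotics

/-- The law `P_g` on `V × 𝒳` of one observation `(Y, X) = (g X + ε, X)`, where the covariate `X`
has law `lam`, the noise `ε` is standard Gaussian on the Euclidean space `V`, and `ε`, `X` are
independent. For the regression model at the parameter `θ`, take `g = 𝒢 θ`. -/
noncomputable def regressionLaw {𝒳 V : Type*} [MeasurableSpace 𝒳]
    [NormedAddCommGroup V] [InnerProductSpace ℝ V] [FiniteDimensional ℝ V]
    [MeasurableSpace V] [BorelSpace V]
    (lam : Measure 𝒳) (g : 𝒳 → V) : Measure (V × 𝒳) :=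
  ((stdGaussian V).prod lam).map (fun p => (g p.2 + p.1, p.2))

/-- The law `P_g^N` on `(V × 𝒳)^N` of `N` independent observations, each with law `P_g`. -/
noncomputable def regressionLawN {𝒳 V : Type*} [MeasurableSpace 𝒳]
    [NormedAddCommGroup V] [InnerProductSpace ℝ V] [FiniteDimensional ℝ V]
    [MeasurableSpace V] [BorelSpace V]
    (lam : Measure 𝒳) (g : 𝒳 → V) (N : ℕ) : Measure (Fin N → V × 𝒳) :=
  Measure.pi (fun _ => regressionLaw lam g)

/-- The linear subspace `H` is a tangent space to `Θ` at `θ`: along every direction `h ∈ H`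
the path `s ↦ θ + s h` stays in `Θ` for all small `s`. -/
def IsTangentSpaceAt {ℍ : Type*} [NormedAddCommGroup ℍ] [InnerProductSpace ℝ ℍ]
    (Θ : Set ℍ) (θ : ℍ) (H : Submodule ℝ ℍ) : Prop :=
  ∀ h ∈ H, ∃ ε > (0 : ℝ), ∀ s : ℝ, |s| < ε → θ + s • h ∈ Θ

/-- The regularity condition on the forward map `𝒢` at `θ` with tangent space `H` and derivative
operator `I`. Only the values of `𝒢` on `Θ` matter. -/
structure ForwardMapCondition {ℍ 𝒳 V : Type*} [NormedAddCommGroup ℍ] [InnerProductSpace ℝ ℍ]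
    [MeasurableSpace 𝒳] [NormedAddCommGroup V] [InnerProductSpace ℝ V]
    (lam : Measure 𝒳) (Θ : Set ℍ) (𝒢 : ℍ → 𝒳 → V) (θ : ℍ) (H : Submodule ℝ ℍ)
    (I : H →L[ℝ] Lp V 2 lam) : Prop where
  /-- `𝒢` is uniformly bounded on `Θ`. -/
  bounded : ∃ U : ℝ, ∀ θ' ∈ Θ, ∀ x, ‖𝒢 θ' x‖ ≤ U
  /-- For every `x`, `𝒢 θ x` is Gateaux differentiable in every direction `h ∈ H`, and `I h` is
  the `L²`-class of the derivative `D`. -/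
  gateaux : ∀ h : H, ∃ D : 𝒳 → V, I h =ᵐ[lam] D ∧ ∀ x,
    (fun s : ℝ => 𝒢 (θ + s • (h : ℍ)) x - 𝒢 θ x - s • D x) =o[𝓝 0] (fun s : ℝ => s)
  /-- The difference quotients are uniformly bounded for small `s`. -/
  lipschitz : ∀ h : H, ∃ ε > (0 : ℝ), ∃ B : ℝ, ∀ s : ℝ, s ≠ 0 → |s| < ε →
    ∀ x, ‖𝒢 (θ + s • (h : ℍ)) x - 𝒢 θ x‖ / |s| ≤ B

/-! Translating a standard Gaussian multiplies its density by an explicit exponential, so the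
log-likelihood ratio is exactly a sum of i.i.d. terms `logLik`. With `δ = g' - g`, such a term under
`P_g` equals `⟪ε, δ X⟫ - ‖δ X‖²/2`, which given `X` is normal with mean `-‖δ X‖²/2` and variance `‖δ
X‖²`. Hence the sum has characteristic function `(∫ exp (c‖δ‖²) dλ) ^ N` with `c = -(t² + i t)/2`.
For `δ_N = 𝒢 (θ + h/√N) - 𝒢 θ`, differentiability and the Lipschitz bound make `N‖δ_N‖²` converge
pointwise and boundedly to `‖D‖²`. Dominated convergence and `(1 + z_N/N) ^ N → exp z` give the
limit `exp (c‖I h‖²)`, the Gaussian characteristic function, and Lévy's continuity theorem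
concludes. Neither a central limit theorem nor a remainder estimate is needed. -/

open scoped RealInnerProductSpace ENNReal

/-! ### Densities of product measures and of Gaussian translates -/

/-- A finite product of measures with densities has the product of the densities as density. -/
lemma pi_withDensity {ι : Type*} [Fintype ι] {α : ι → Type*} [∀ i, MeasurableSpace (α i)]
    (μ : ∀ i, Measure (α i)) [∀ i, IsProbabilityMeasure (μ i)]
    {f : ∀ i, α i → ℝ≥0∞} (hf : ∀ i, Measurable (f i))
    [∀ i, SigmaFinite ((μ i).withDensity (f i))] :
    Measure.pi (fun i => (μ i).withDensity (f i)) =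
      (Measure.pi μ).withDensity (fun x => ∏ i, f i (x i)) := by
  refine Measure.pi_eq fun s hs => ?_
  rw [withDensity_apply _ (.univ_pi hs), ← lintegral_indicator (.univ_pi hs)]
  have hX : ∀ i, Measurable ((s i).indicator (f i)) := fun i => (hf i).indicator (hs i)
  have h1 := lintegral_prod_eq_prod_lintegral_of_indepFun Finset.univ
    (fun i (x : ∀ i, α i) => (s i).indicator (f i) (x i))
    (iIndepFun_pi (μ := μ) fun i => (hX i).aemeasurable)
    (fun i => (hX i).comp (measurable_pi_apply i))
  have h2 : ∀ x : ∀ i, α i, (Set.univ.pi s).indicator (fun x => ∏ i, f i (x i)) x =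
      ∏ i, (s i).indicator (f i) (x i) := by
    intro x
    by_cases hx : x ∈ Set.univ.pi s
    · rw [Set.indicator_of_mem hx]
      exact Finset.prod_congr rfl fun i _ => by rw [Set.indicator_of_mem (hx i trivial)]
    · rw [Set.indicator_of_notMem hx]
      obtain ⟨i, hi⟩ : ∃ i, x i ∉ s i := by simpa [Set.mem_pi] using hx
      exact (Finset.prod_eq_zero (Finset.mem_univ i) (Set.indicator_of_notMem hi _)).symm
  simp_rw [h2]
  rw [h1]
  refine Finset.prod_congr rfl fun i _ => ?_
  rw [withDensity_apply _ (hs i), ← lintegral_indicator (hs i)]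
  exact lintegral_map (μ := Measure.pi μ) (hX i) (measurable_pi_apply i) |>.symm.trans
    (by rw [(measurePreserving_eval μ i).map_eq])

lemma withDensity_map_comp {α β : Type*} [MeasurableSpace α] [MeasurableSpace β]
    (μ : Measure α) {T : α → β} (hT : Measurable T) {f : β → ℝ≥0∞} (hf : Measurable f) :
    (μ.map T).withDensity f = (μ.withDensity (f ∘ T)).map T := by
  ext s hs
  rw [withDensity_apply _ hs, Measure.map_apply hT hs, withDensity_apply _ (hT hs),
    setLIntegral_map hs hf hT]
  rfl

/-- The density of a translate of the standard Gaussian law on `ℝ`. -/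
lemma gaussianReal_map_add_const_eq_withDensity (a : ℝ) :
    (gaussianReal 0 1).map (· + a) =
      (gaussianReal 0 1).withDensity (fun x => ENNReal.ofReal (Real.exp (x * a - a ^ 2 / 2))) := by
  rw [gaussianReal_map_add_const, gaussianReal_of_var_ne_zero _ one_ne_zero,
    gaussianReal_of_var_ne_zero _ one_ne_zero, ← withDensity_mul _ (by fun_prop) (by fun_prop)]
  congr 1
  ext x
  simp only [Pi.mul_apply, gaussianPDF, gaussianPDFReal]
  rw [← ENNReal.ofReal_mul (by positivity), mul_assoc (√_)⁻¹, ← Real.exp_add]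
  congr 3
  simp
  ring

/-- The density of a translate of the standard Gaussian law on a Euclidean space. -/
lemma stdGaussian_map_add_const {V : Type*}
    [NormedAddCommGroup V] [InnerProductSpace ℝ V] [FiniteDimensional ℝ V]
    [MeasurableSpace V] [BorelSpace V] (v : V) :
    (stdGaussian V).map (· + v) =
      (stdGaussian V).withDensity
        (fun x => ENNReal.ofReal (Real.exp (⟪x, v⟫ - ‖v‖ ^ 2 / 2))) := by
  set b := stdOrthonormalBasis ℝ V
  have hT : Measurable (fun x : Fin (Module.finrank ℝ V) → ℝ => ∑ i, x i • b i) := by fun_prop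
  have hsh : Measurable (fun (x : Fin (Module.finrank ℝ V) → ℝ) i => x i + ⟪b i, v⟫) := by fun_prop
  have hpi : (Measure.pi fun _ : Fin (Module.finrank ℝ V) => gaussianReal 0 1).map
        (fun x i => x i + ⟪b i, v⟫) =
      (Measure.pi fun _ : Fin (Module.finrank ℝ V) => gaussianReal 0 1).withDensity
        (fun x => ∏ i, ENNReal.ofReal (Real.exp (x i * ⟪b i, v⟫ - ⟪b i, v⟫ ^ 2 / 2))) := by
    have hs : ∀ i, IsProbabilityMeasure ((gaussianReal 0 1).map (· + ⟪b i, v⟫)) := fun i =>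
      Measure.isProbabilityMeasure_map (by fun_prop)
    rw [Measure.pi_map_pi (μ := fun _ => gaussianReal 0 1) (f := fun i y => y + ⟪b i, v⟫)
      (fun i => by fun_prop)]
    -- Rewriting `hs` too supplies the σ-finiteness instance that `pi_withDensity` requires.
    simp_rw [gaussianReal_map_add_const_eq_withDensity] at hs ⊢
    exact pi_withDensity (fun _ => gaussianReal 0 1)
      (f := fun i y => ENNReal.ofReal (Real.exp (y * ⟪b i, v⟫ - ⟪b i, v⟫ ^ 2 / 2)))
      (fun i => by fun_prop)
  -- In orthonormal coordinates, translation by `v` acts on each coordinate separately.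
  have hcomp : (fun x : V => x + v) ∘ (fun x : Fin (Module.finrank ℝ V) → ℝ => ∑ i, x i • b i) =
      (fun x : Fin (Module.finrank ℝ V) → ℝ => ∑ i, x i • b i) ∘ (fun x i => x i + ⟪b i, v⟫) := by
    ext x
    simp only [Function.comp_apply, add_smul, Finset.sum_add_distrib, b.sum_repr']
  rw [stdGaussian_eq_map_pi_orthonormalBasis b, withDensity_map_comp _ hT (by fun_prop),
    Measure.map_map (by fun_prop) hT, hcomp, ← Measure.map_map hT hsh, hpi]
  congr 2
  ext x
  rw [← ENNReal.ofReal_prod_of_nonneg fun i _ => (Real.exp_pos _).le, ← Real.exp_sum,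
    Finset.sum_sub_distrib, ← Finset.sum_div, b.sum_sq_inner_right]
  simp [sum_inner, real_inner_smul_left]

/-! ### Likelihood ratios in the regression model -/

section Regression

variable {𝒳 V : Type*} [MeasurableSpace 𝒳]
  [NormedAddCommGroup V] [InnerProductSpace ℝ V] [FiniteDimensional ℝ V]
  [MeasurableSpace V] [BorelSpace V]

/-- The log-likelihood ratio of one observation for the regression functions `g'` and `g`. -/
noncomputable def logLik (g g' : 𝒳 → V) (z : V × 𝒳) : ℝ :=
  ⟪z.1 - g z.2, g' z.2 - g z.2⟫ - ‖g' z.2 - g z.2‖ ^ 2 / 2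

lemma measurable_logLik {g g' : 𝒳 → V} (hg : Measurable g) (hg' : Measurable g') :
    Measurable (logLik g g') := by
  unfold logLik
  fun_prop

variable (lam : Measure 𝒳) [IsProbabilityMeasure lam]

lemma isProbabilityMeasure_regressionLaw {g : 𝒳 → V} (hg : Measurable g) :
    IsProbabilityMeasure (regressionLaw lam g) :=
  Measure.isProbabilityMeasure_map (by fun_prop)

lemma lintegral_regressionLaw {g : 𝒳 → V} (hg : Measurable g) {F : V × 𝒳 → ℝ≥0∞}
    (hF : Measurable F) :
    ∫⁻ z, F z ∂(regressionLaw lam g) = ∫⁻ x, ∫⁻ e, F (g x + e, x) ∂(stdGaussian V) ∂lam := by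
  rw [regressionLaw, lintegral_map hF (by fun_prop), lintegral_prod_symm _ (by fun_prop)]

/-- Conditionally on `X = x`, the two laws of `Y` differ by the translation `g' x - g x`, so the
Gaussian shift formula applies fibrewise. -/
lemma regressionLaw_eq_withDensity {g g' : 𝒳 → V} (hg : Measurable g) (hg' : Measurable g') :
    regressionLaw lam g' = (regressionLaw lam g).withDensity
      (fun z => ENNReal.ofReal (Real.exp (logLik g g' z))) := by
  have hL := measurable_logLik hg hg'
  refine Measure.ext_of_lintegral _ fun F hF => ?_
  rw [lintegral_withDensity_eq_lintegral_mul _ (by fun_prop) hF, lintegral_regressionLaw lam hg' hF,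
    lintegral_regressionLaw lam hg (Measurable.mul (by fun_prop) hF)]
  refine lintegral_congr fun x => ?_
  have h1 : ∫⁻ e, F (g' x + e, x) ∂(stdGaussian V) =
      ∫⁻ e, F (g x + e, x) ∂((stdGaussian V).map (· + (g' x - g x))) := by
    rw [lintegral_map (by fun_prop) (by fun_prop)]
    refine lintegral_congr fun e => ?_
    congr 2
    abel
  rw [h1, stdGaussian_map_add_const,
    lintegral_withDensity_eq_lintegral_mul _ (by fun_prop) (by fun_prop)]
  simp [logLik]

lemma regressionLawN_eq_withDensity {g g' : 𝒳 → V} (hg : Measurable g) (hg' : Measurable g')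
    (N : ℕ) :
    regressionLawN lam g' N = (regressionLawN lam g N).withDensity
      (fun z => ENNReal.ofReal (Real.exp (∑ i, logLik g g' (z i)))) := by
  have hL := measurable_logLik hg hg'
  have := isProbabilityMeasure_regressionLaw lam hg
  have := isProbabilityMeasure_regressionLaw lam hg'
  simp_rw [regressionLawN]
  rw [regressionLaw_eq_withDensity lam hg hg'] at this ⊢
  rw [pi_withDensity (fun _ : Fin N => regressionLaw lam g)
    (f := fun _ z => ENNReal.ofReal (Real.exp (logLik g g' z))) (fun _ => by fun_prop)]
  congr 1
  ext z
  rw [← ENNReal.ofReal_prod_of_nonneg fun i _ => (Real.exp_pos _).le, ← Real.exp_sum]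

lemma regressionLawN_absolutelyContinuous {g g' : 𝒳 → V} (hg : Measurable g)
    (hg' : Measurable g') (N : ℕ) : regressionLawN lam g' N ≪ regressionLawN lam g N := by
  rw [regressionLawN_eq_withDensity lam hg hg']
  exact withDensity_absolutelyContinuous _ _

lemma log_rnDeriv_regressionLawN {g g' : 𝒳 → V} (hg : Measurable g) (hg' : Measurable g')
    (N : ℕ) :
    (fun z => Real.log ((regressionLawN lam g' N).rnDeriv (regressionLawN lam g N) z).toReal)
      =ᵐ[regressionLawN lam g N] fun z => ∑ i, logLik g g' (z i) := by
  have hL := measurable_logLik hg hg'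
  have := isProbabilityMeasure_regressionLaw lam hg
  have : IsProbabilityMeasure (regressionLawN lam g N) := by
    unfold regressionLawN; infer_instance
  rw [regressionLawN_eq_withDensity lam hg hg']
  filter_upwards [Measure.rnDeriv_withDensity (regressionLawN lam g N)
    (f := fun z => ENNReal.ofReal (Real.exp (∑ i, logLik g g' (z i)))) (by fun_prop)] with z hz
  rw [hz, ENNReal.toReal_ofReal (Real.exp_pos _).le, Real.log_exp]

/-- Integrating out the noise first leaves the Gaussian characteristic function at `t • (g' x - g
x)`. -/
lemma integral_cexp_logLik {g g' : 𝒳 → V} (hg : Measurable g) (hg' : Measurable g') (t : ℝ) :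
    ∫ z, Complex.exp (t * logLik g g' z * Complex.I) ∂(regressionLaw lam g) =
      ∫ x, Complex.exp (-((t ^ 2 + t * Complex.I) / 2) * (‖g' x - g x‖ : ℂ) ^ 2) ∂lam := by
  have hL := measurable_logLik hg hg'
  have hT : Measurable (fun p : V × 𝒳 => (g p.2 + p.1, p.2)) := by fun_prop
  rw [regressionLaw, integral_map hT.aemeasurable
    (Measurable.aestronglyMeasurable (by fun_prop)), integral_prod_symm]
  swap
  · refine Integrable.of_bound (C := 1) (Measurable.aestronglyMeasurable (by fun_prop)) ?_
    refine ae_of_all _ fun p => ?_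
    rw [← Complex.ofReal_mul, Complex.norm_exp_ofReal_mul_I]
  refine integral_congr_ae (ae_of_all _ fun x => ?_)
  have h1 : ∀ e : V, Complex.exp (t * (logLik g g' (g x + e, x) : ℝ) * Complex.I) =
      Complex.exp (-(t * Complex.I / 2) * (‖g' x - g x‖ : ℂ) ^ 2) *
        Complex.exp ((⟪e, t • (g' x - g x)⟫ : ℝ) * Complex.I) := by
    intro e
    rw [← Complex.exp_add]
    congr 1
    simp only [logLik, add_sub_cancel_left, real_inner_smul_right]
    push_cast
    ring
  simp only [h1]
  rw [integral_const_mul, ← charFun_apply, charFun_stdGaussian, ← Complex.exp_add, norm_smul]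
  congr 1
  have : ((‖t‖ : ℝ) : ℂ) ^ 2 = (t : ℂ) ^ 2 := by
    rw [← Complex.ofReal_pow, Real.norm_eq_abs, sq_abs, Complex.ofReal_pow]
  push_cast
  rw [mul_pow, this]
  ring

lemma charFun_map_sum_logLik {g g' : 𝒳 → V} (hg : Measurable g) (hg' : Measurable g') (N : ℕ)
    (t : ℝ) :
    charFun ((regressionLawN lam g N).map (fun z => ∑ i, logLik g g' (z i))) t =
      (∫ x, Complex.exp (-((t ^ 2 + t * Complex.I) / 2) * (‖g' x - g x‖ : ℂ) ^ 2) ∂lam) ^ N := by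
  have hL := measurable_logLik hg hg'
  have := isProbabilityMeasure_regressionLaw lam hg
  rw [charFun_apply_real, integral_map (Measurable.aemeasurable (by fun_prop))
    (Measurable.aestronglyMeasurable (by fun_prop)), ← integral_cexp_logLik lam hg hg' t]
  have h1 : ∀ z : Fin N → V × 𝒳,
      Complex.exp (t * ((∑ i, logLik g g' (z i) : ℝ) : ℂ) * Complex.I) =
        ∏ i, Complex.exp (t * logLik g g' (z i) * Complex.I) := by
    intro z
    rw [← Complex.exp_sum, Complex.ofReal_sum, Finset.mul_sum, Finset.sum_mul]
  simp_rw [h1, regressionLawN]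
  rw [integral_fintype_prod_eq_pow (fun z => Complex.exp (t * logLik g g' z * Complex.I)),
    Fintype.card_fin]

end Regression

/-! ### Limit of the characteristic functions -/

/-- If `n * w n → z` then `n * (exp (w n) - 1) → z`. -/
lemma tendsto_natCast_mul_cexp_sub_one {w : ℕ → ℂ} {z : ℂ}
    (hw : Tendsto (fun n : ℕ => (n : ℂ) * w n) atTop (𝓝 z)) :
    Tendsto (fun n : ℕ => (n : ℂ) * (Complex.exp (w n) - 1)) atTop (𝓝 z) := by
  have hw0 : Tendsto w atTop (𝓝 0) := by
    have h1 := hw.mul (tendsto_inv_atTop_nhds_zero_nat (𝕜 := ℂ))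
    rw [mul_zero] at h1
    refine h1.congr' ?_
    filter_upwards [eventually_ne_atTop 0] with n hn
    have : (n : ℂ) ≠ 0 := Nat.cast_ne_zero.2 hn
    field_simp
  have h2 : Tendsto (fun n : ℕ => (n : ℂ) * (Complex.exp (w n) - 1 - w n)) atTop (𝓝 0) := by
    refine squeeze_zero_norm' (a := fun n : ℕ => ‖(n : ℂ) * w n‖ * ‖w n‖) ?_ ?_
    · have h3 : ∀ᶠ n in atTop, ‖w n‖ < 1 := by
        have := hw0.norm
        rw [norm_zero] at this
        exact this.eventually_lt_const one_pos
      filter_upwards [h3] with n hn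
      rw [norm_mul, norm_mul, mul_assoc, ← sq]
      gcongr
      exact Complex.norm_exp_sub_one_sub_id_le hn.le
    · simpa using hw.norm.mul hw0.norm
  simpa [mul_sub] using h2.add hw

/-- Convergence of the characteristic functions of a triangular array with increments `δ n`
of size `n ^ (-1/2)`. -/
lemma tendsto_integral_cexp_norm_sq_pow {𝒳 V : Type*} [MeasurableSpace 𝒳]
    [NormedAddCommGroup V] [NormedSpace ℝ V] [MeasurableSpace V] [BorelSpace V]
    (lam : Measure 𝒳) [IsProbabilityMeasure lam] (c : ℂ)
    {δ : ℕ → 𝒳 → V} {D : 𝒳 → V} {B : ℝ}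
    (hδ : ∀ᶠ n in atTop, Measurable (δ n))
    (hB : ∀ᶠ n : ℕ in atTop, ∀ x, √(n : ℝ) * ‖δ n x‖ ≤ B)
    (hD : ∀ x, Tendsto (fun n : ℕ => √(n : ℝ) * ‖δ n x‖) atTop (𝓝 ‖D x‖)) :
    Tendsto (fun n : ℕ => (∫ x, Complex.exp (c * (‖δ n x‖ : ℂ) ^ 2) ∂lam) ^ n) atTop
      (𝓝 (Complex.exp (c * ((∫ x, ‖D x‖ ^ 2 ∂lam : ℝ) : ℂ)))) := by
  -- The first bound permits `‖exp w - 1‖ ≤ 2‖w‖`; the second then gives a constant dominating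
  -- function. The first follows from the second once `n ≥ ‖c‖ * B ^ 2`.
  have hbd : ∀ᶠ n : ℕ in atTop, ∀ x, ‖c * (‖δ n x‖ : ℂ) ^ 2‖ ≤ 1 ∧
      ‖(n : ℂ) * (c * (‖δ n x‖ : ℂ) ^ 2)‖ ≤ ‖c‖ * B ^ 2 := by
    have h0 : ∀ᶠ n : ℕ in atTop, ‖c‖ * B ^ 2 ≤ n :=
      tendsto_natCast_atTop_atTop.eventually_ge_atTop _
    filter_upwards [hB, h0, eventually_gt_atTop 0] with n hn h0 hpos x
    have h1 : (n : ℝ) * ‖δ n x‖ ^ 2 ≤ B ^ 2 := by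
      have := pow_le_pow_left₀ (by positivity) (hn x) 2
      rwa [mul_pow, Real.sq_sqrt (Nat.cast_nonneg n)] at this
    have h2 : ‖(n : ℂ) * (c * (‖δ n x‖ : ℂ) ^ 2)‖ ≤ ‖c‖ * B ^ 2 := by
      simp only [norm_mul, norm_pow, Complex.norm_natCast, Complex.norm_real, norm_norm]
      calc (n : ℝ) * (‖c‖ * ‖δ n x‖ ^ 2) = ‖c‖ * (n * ‖δ n x‖ ^ 2) := by ring
        _ ≤ ‖c‖ * B ^ 2 := by gcongr
    refine ⟨?_, h2⟩
    have hn0 : (0 : ℝ) < n := Nat.cast_pos.2 hpos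
    rw [norm_mul, Complex.norm_natCast] at h2
    by_contra! hlt
    nlinarith
  have hlim : Tendsto (fun n : ℕ => ∫ x, (n : ℂ) * (Complex.exp (c * (‖δ n x‖ : ℂ) ^ 2) - 1) ∂lam)
      atTop (𝓝 (∫ x, c * ((‖D x‖ ^ 2 : ℝ) : ℂ) ∂lam)) := by
    refine tendsto_integral_filter_of_dominated_convergence (fun _ => 2 * (‖c‖ * B ^ 2)) ?_ ?_
      (integrable_const _) ?_
    · filter_upwards [hδ] with n hn
      exact Measurable.aestronglyMeasurable (by fun_prop)
    · filter_upwards [hbd] with n hn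
      refine ae_of_all _ fun x => ?_
      obtain ⟨h1, h2⟩ := hn x
      calc ‖(n : ℂ) * (Complex.exp (c * (‖δ n x‖ : ℂ) ^ 2) - 1)‖
          ≤ ‖(n : ℂ)‖ * (2 * ‖c * (‖δ n x‖ : ℂ) ^ 2‖) := by
            rw [norm_mul]
            gcongr
            exact Complex.norm_exp_sub_one_le h1
        _ = 2 * ‖(n : ℂ) * (c * (‖δ n x‖ : ℂ) ^ 2)‖ := by rw [norm_mul (n : ℂ)]; ring
        _ ≤ _ := by gcongr
    · refine ae_of_all _ fun x => tendsto_natCast_mul_cexp_sub_one ?_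
      have h1 := (Complex.continuous_ofReal.tendsto _).comp ((hD x).pow 2)
      refine (h1.const_mul c).congr fun n => ?_
      simp only [Function.comp_apply, mul_pow, Real.sq_sqrt (Nat.cast_nonneg n)]
      push_cast
      ring
  rw [integral_const_mul, integral_complex_ofReal] at hlim
  have hlim' : Tendsto (fun n : ℕ => (n : ℂ) *
      ((∫ x, Complex.exp (c * (‖δ n x‖ : ℂ) ^ 2) ∂lam) - 1)) atTop
      (𝓝 (c * ((∫ x, ‖D x‖ ^ 2 ∂lam : ℝ) : ℂ))) := by
    refine hlim.congr' ?_
    filter_upwards [hδ, hbd] with n hn hb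
    have hint : Integrable (fun x => Complex.exp (c * (‖δ n x‖ : ℂ) ^ 2)) lam := by
      refine Integrable.of_bound (C := Real.exp 1)
        (Measurable.aestronglyMeasurable (by fun_prop)) (ae_of_all _ fun x => ?_)
      exact (Complex.norm_exp_le_exp_norm _).trans (Real.exp_le_exp.2 (hb x).1)
    rw [integral_const_mul, integral_sub hint (integrable_const _)]
    simp
  simpa using Complex.tendsto_one_add_pow_exp_of_tendsto hlim'

lemma tendsto_one_div_sqrt_natCast : Tendsto (fun n : ℕ => 1 / √(n : ℝ)) atTop (𝓝 0) := by
  simp_rw [one_div]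
  exact (Real.tendsto_sqrt_atTop.comp tendsto_natCast_atTop_atTop).inv_tendsto_atTop

lemma tendsto_sqrt_natCast_mul_norm {V : Type*} [NormedAddCommGroup V] [NormedSpace ℝ V]
    {f : ℝ → V} {d : V} (hf : (fun s : ℝ => f s - s • d) =o[𝓝 0] fun s : ℝ => s) :
    Tendsto (fun n : ℕ => √(n : ℝ) * ‖f (1 / √(n : ℝ))‖) atTop (𝓝 ‖d‖) := by
  have h1 := (hf.comp_tendsto tendsto_one_div_sqrt_natCast).tendsto_inv_smul_nhds_zero
  have h2 : Tendsto (fun n : ℕ => √(n : ℝ) • f (1 / √(n : ℝ))) atTop (𝓝 d) := by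
    have h3 := h1.add_const d
    rw [zero_add] at h3
    refine h3.congr' ?_
    filter_upwards [eventually_gt_atTop 0] with n hn
    have : √(n : ℝ) ≠ 0 := (Real.sqrt_pos.2 (Nat.cast_pos.2 hn)).ne'
    simp [smul_sub, smul_smul, this]
  refine h2.norm.congr fun n => ?_
  rw [norm_smul, Real.norm_of_nonneg (Real.sqrt_nonneg _)]

lemma norm_sq_Lp_two_eq_integral {𝒳 V : Type*} [MeasurableSpace 𝒳] [NormedAddCommGroup V]
    [InnerProductSpace ℝ V] {lam : Measure 𝒳} {f : Lp V 2 lam} {D : 𝒳 → V} (h : f =ᵐ[lam] D) :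
    ‖f‖ ^ 2 = ∫ x, ‖D x‖ ^ 2 ∂lam := by
  rw [← real_inner_self_eq_norm_sq, L2.inner_def]
  refine integral_congr_ae ?_
  filter_upwards [h] with x hx
  rw [hx, real_inner_self_eq_norm_sq]

/-! ### Main theorem -/

theorem mainTheorem12
    {ℍ 𝒳 V : Type*}
    [NormedAddCommGroup ℍ] [InnerProductSpace ℝ ℍ] [CompleteSpace ℍ]
    [MeasurableSpace 𝒳]
    [NormedAddCommGroup V] [InnerProductSpace ℝ V] [FiniteDimensional ℝ V]
    [MeasurableSpace V] [BorelSpace V]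
    (lam : Measure 𝒳) [IsProbabilityMeasure lam]
    (Θ : Set ℍ) (𝒢 : ℍ → 𝒳 → V) (h𝒢 : ∀ θ' ∈ Θ, Measurable (𝒢 θ'))
    (θ : ℍ) (hθ : θ ∈ Θ)
    (H : Submodule ℝ ℍ) (hH : IsTangentSpaceAt Θ θ H)
    (I : H →L[ℝ] Lp V 2 lam) (hI : ForwardMapCondition lam Θ 𝒢 θ H I)
    {Ω : ℕ → Type*} [∀ N, MeasurableSpace (Ω N)]
    (Q : ∀ N, Measure (Ω N)) [∀ N, IsProbabilityMeasure (Q N)]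
    (D : ∀ N, Ω N → Fin N → V × 𝒳)
    (hD : ∀ N, HasLaw (D N) (regressionLawN lam (𝒢 θ) N) (Q N))
    (h : H) :
    (∀ᶠ N : ℕ in atTop,
      regressionLawN lam (𝒢 (θ + (1 / √(N : ℝ)) • (h : ℍ))) N ≪ regressionLawN lam (𝒢 θ) N ∧
      regressionLawN lam (𝒢 θ) N ≪ regressionLawN lam (𝒢 (θ + (1 / √(N : ℝ)) • (h : ℍ))) N) ∧
    TendstoInDistribution
      (fun (N : ℕ) (ω : Ω N) =>
        Real.log ((regressionLawN lam (𝒢 (θ + (1 / √(N : ℝ)) • (h : ℍ))) N).rnDeriv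
          (regressionLawN lam (𝒢 θ) N) (D N ω)).toReal)
      atTop (id : ℝ → ℝ) Q (gaussianReal (-(1 / 2) * ‖I h‖ ^ 2) (‖I h‖₊ ^ 2)) := by
  obtain ⟨ε₀, hε₀, hΘ⟩ := hH h h.2
  obtain ⟨ε₁, hε₁, B, hB⟩ := hI.lipschitz h
  obtain ⟨d, hd, hdiff⟩ := hI.gateaux h
  set s : ℕ → ℝ := fun N => 1 / √(N : ℝ) with hs_def
  have hs : Tendsto s atTop (𝓝 0) := tendsto_one_div_sqrt_natCast
  have hs_small : ∀ ε > 0, ∀ᶠ N in atTop, |s N| < ε := fun ε hε => by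
    have := hs.abs
    rw [abs_zero] at this
    exact this.eventually_lt_const hε
  have hg : Measurable (𝒢 θ) := h𝒢 θ hθ
  have hg' : ∀ᶠ N in atTop, Measurable (𝒢 (θ + s N • (h : ℍ))) := by
    filter_upwards [hs_small ε₀ hε₀] with N hN
    exact h𝒢 _ (hΘ _ hN)
  refine ⟨?_, ?_⟩
  · filter_upwards [hg'] with N hN
    exact ⟨regressionLawN_absolutelyContinuous lam hg hN N,
      regressionLawN_absolutelyContinuous lam hN hg N⟩
  have hmeas : ∀ N, Measurable (fun z => Real.log
      ((regressionLawN lam (𝒢 (θ + s N • (h : ℍ))) N).rnDeriv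
        (regressionLawN lam (𝒢 θ) N) z).toReal) := fun N =>
    Real.measurable_log.comp (Measure.measurable_rnDeriv _ _).ennreal_toReal
  refine ⟨fun N => (hmeas N).comp_aemeasurable (hD N).aemeasurable, by fun_prop, ?_⟩
  refine ProbabilityMeasure.tendsto_of_tendsto_charFun fun t => ?_
  have hlim := tendsto_integral_cexp_norm_sq_pow lam (-((t ^ 2 + t * Complex.I) / 2))
    (δ := fun N x => 𝒢 (θ + s N • (h : ℍ)) x - 𝒢 θ x) (D := d) (B := B)
    (by filter_upwards [hg'] with N hN using hN.sub hg)
    (by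
      filter_upwards [hs_small ε₁ hε₁, eventually_gt_atTop 0] with N hN hpos x
      have hsq : 0 < √(N : ℝ) := Real.sqrt_pos.2 (Nat.cast_pos.2 hpos)
      have hsN : 0 < s N := one_div_pos.2 hsq
      have := hB (s N) hsN.ne' hN x
      rw [abs_of_pos hsN] at this
      simpa [hs_def, mul_comm] using this)
    (fun x => tendsto_sqrt_natCast_mul_norm
      (f := fun s => 𝒢 (θ + s • (h : ℍ)) x - 𝒢 θ x) (hdiff x))
  rw [← norm_sq_Lp_two_eq_integral hd] at hlim
  have hchar : charFun ((gaussianReal (-(1 / 2) * ‖I h‖ ^ 2) (‖I h‖₊ ^ 2)).map (id : ℝ → ℝ)) t =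
      Complex.exp (-((t ^ 2 + t * Complex.I) / 2) * ((‖I h‖ ^ 2 : ℝ) : ℂ)) := by
    rw [Measure.map_id, charFun_gaussianReal]
    congr 1
    push_cast
    ring
  simp only [ProbabilityMeasure.coe_mk]
  rw [hchar]
  refine hlim.congr' ?_
  filter_upwards [hg'] with N hN
  -- The law of the ratio at `D N` depends only on the law of `D N`, so it can be computed under
  -- `regressionLawN`.
  have hmap := AEMeasurable.map_map_of_aemeasurable (hmeas N).aemeasurable (hD N).aemeasurable
  rw [(hD N).map_eq] at hmap
  rw [← charFun_map_sum_logLik lam hg hN N t,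
    ← Measure.map_congr (log_rnDeriv_regressionLawN lam hg hN N)]
  exact congrArg (charFun · t) hmap
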